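/- Let $p$ be a prime, let $\mathbb{F}_q$ be a finite field of characteristic $p$, let $F$ be a perfect field of characteristic $p$, and let $n\ge 2$ and $r$ be integers with $p\ge n$. Let $\mathbf{G}$ be either $\mathrm{GL}_n$ or $\mathrm{SL}_n$, and let $W_r(\mathbb{F}_q)$ be the ring of ($p$-typical) Witt vectors of length $r$ over $\mathbb{F}_q$. Then the group algebras $F[\mathbf{G}(W_r(\mathbb{F}_q))]$ and $F[\mathbf{G}(\mathbb{F}_q[t]/t^r)]$ are not stably equivalent of Morita type in each of the following cases: - $r=2$ and $p\ge 2n$; - $r=3$ and $p\ge 3$; - $r\ge 4$ (and $p \geq 2$). Here two $F$-algebras $A$ and $B$ are called stably equivalent of Morita type if there are a $B$-$A$-bimodule $M$ and an $A$-$B$-bimodule $N$ such that $M$ is projective as a left $B$-module and as a right $A$-module, $N$ is projective as a left $A$-module and as a right $B$-module, $M\otimes_A N\cong B\oplus Q$ as $B$-$B$-bimodules with $Q$ a finitely generated projective $B$-$B$-bimodule, and $N\otimes_B M\cong A\oplus P$ as $A$-$A$-bimodules with $P$ a finitely generated projective $A$-$A$-bimodule. (Bimodules are $F$-central, i.e.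 a $B$-$A$-bimodule is a module over $B\otimes_F A^{\mathrm{op}}$.) -/

import Mathlib

universe v u uA uB uC uM uN

noncomputable section

open scoped TensorProduct

/-! A `B`-`A`-bimodule over the commutative ring `F` is an abelian group with commuting actions of
`B` (on the left) and of `Aᵐᵒᵖ` (that is, of `A` on the right), such that `F` acts in the same way
through `B` and through `A`; equivalently, a module over `B ⊗[F] Aᵐᵒᵖ`. -/

section BalancedTensor

variable (F : Type u) (A : Type uA) {B : Type uB} {C : Type uC} (M : Type uM) (N : Type uN)
  [CommRing F] [Ring A]
  [AddCommGroup M] [Module F M] [Module Aᵐᵒᵖ M] [AddCommGroup N] [Module F N] [Module A N]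

/-- The submodule of `M ⊗[F] N` spanned by the elements `(m a) ⊗ n - m ⊗ (a n)`. -/
def balancedRelations : Submodule F (M ⊗[F] N) :=
  Submodule.span F
    {z | ∃ (m : M) (a : A) (n : N), z = (MulOpposite.op a • m) ⊗ₜ[F] n - m ⊗ₜ[F] (a • n)}

/-- The tensor product `M ⊗_A N` of a right `A`-module `M` and a left `A`-module `N` over the
(not necessarily commutative) `F`-algebra `A`. -/
abbrev BalancedTensor : Type (max uM uN) :=
  (M ⊗[F] N) ⧸ balancedRelations F A M N

variable [Ring B] [Algebra F B] [Ring C] [Algebra F C]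
  [Module B M] [IsScalarTower F B M] [SMulCommClass B Aᵐᵒᵖ M]
  [Module Cᵐᵒᵖ N] [IsScalarTower F Cᵐᵒᵖ N] [SMulCommClass A Cᵐᵒᵖ N]

/-- The class `m ⊗ n` in `M ⊗_A N`. -/
def BalancedTensor.tmul {M : Type uM} {N : Type uN}
    [AddCommGroup M] [Module F M] [Module Aᵐᵒᵖ M] [AddCommGroup N] [Module F N] [Module A N]
    (m : M) (n : N) : BalancedTensor F A M N :=
  Submodule.Quotient.mk (m ⊗ₜ[F] n)

/-- The left action of `b : B` on `M ⊗_A N`, for a `B`-`A`-bimodule `M`: `b (m ⊗ n) = (b m) ⊗ n`. -/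
def BalancedTensor.left (b : B) : BalancedTensor F A M N →ₗ[F] BalancedTensor F A M N :=
  Submodule.mapQ (balancedRelations F A M N) (balancedRelations F A M N)
    ((Algebra.lsmul F F M b).rTensor N) (by
      refine Submodule.span_le.2 ?_
      rintro _ ⟨m, a, n, rfl⟩
      refine Submodule.subset_span ⟨b • m, a, n, ?_⟩
      simp [smul_comm])

/-- The right action of `c : C` on `M ⊗_A N`, for an `A`-`C`-bimodule `N`:
`(m ⊗ n) c = m ⊗ (n c)`. -/
def BalancedTensor.right (c : C) : BalancedTensor F A M N →ₗ[F] BalancedTensor F A M N :=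
  Submodule.mapQ (balancedRelations F A M N) (balancedRelations F A M N)
    ((Algebra.lsmul F F N (MulOpposite.op c)).lTensor M) (by
      refine Submodule.span_le.2 ?_
      rintro _ ⟨m, a, n, rfl⟩
      refine Submodule.subset_span ⟨m, a, MulOpposite.op c • n, ?_⟩
      simp [smul_comm])

theorem BalancedTensor.left_tmul (b : B) (m : M) (n : N) :
    BalancedTensor.left F A M N b (BalancedTensor.tmul F A m n)
      = BalancedTensor.tmul F A (b • m) n := rfl

theorem BalancedTensor.right_tmul (c : C) (m : M) (n : N) :
    BalancedTensor.right F A M N c (BalancedTensor.tmul F A m n)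
      = BalancedTensor.tmul F A m (MulOpposite.op c • n) := rfl

end BalancedTensor

section StableEquivalence

attribute [local instance] TensorProduct.Algebra.module

/-- For a `B`-`A`-bimodule `M` and an `A`-`B`-bimodule `N`, the assertion that
`M ⊗_A N ≅ B ⊕ Q` as `B`-`B`-bimodules for some finitely generated projective `B`-`B`-bimodule `Q`,
that is, a finitely generated projective module over `B ⊗[F] Bᵐᵒᵖ`. -/
def TensorIsoRegularAddProjective (F : Type u) (B : Type uB) (A : Type uA) (M N : Type v)
    [CommRing F] [Ring A] [Algebra F A] [Ring B] [Algebra F B]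
    [AddCommGroup M] [Module F M] [Module B M] [Module Aᵐᵒᵖ M]
    [IsScalarTower F B M] [SMulCommClass B Aᵐᵒᵖ M]
    [AddCommGroup N] [Module F N] [Module A N] [Module Bᵐᵒᵖ N]
    [IsScalarTower F Bᵐᵒᵖ N] [SMulCommClass A Bᵐᵒᵖ N] : Prop :=
  ∃ (Q : Type v) (_ : AddCommGroup Q) (_ : Module F Q) (_ : Module B Q) (_ : Module Bᵐᵒᵖ Q)
    (_ : IsScalarTower F B Q) (_ : IsScalarTower F Bᵐᵒᵖ Q) (_ : SMulCommClass B Bᵐᵒᵖ Q),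
    Module.Finite (B ⊗[F] Bᵐᵒᵖ) Q ∧ Module.Projective (B ⊗[F] Bᵐᵒᵖ) Q ∧
    ∃ e : BalancedTensor F A M N ≃ₗ[F] B × Q,
      (∀ (b : B) (x : BalancedTensor F A M N),
        e (BalancedTensor.left F A M N b x) = b • e x) ∧
      (∀ (b : B) (x : BalancedTensor F A M N),
        e (BalancedTensor.right F A M N b x) = MulOpposite.op b • e x)

/-- Two `F`-algebras `A` and `B` are stably equivalent of Morita type if there are a
`B`-`A`-bimodule `M` and an `A`-`B`-bimodule `N`, each projective as a left and as a right module,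
such that `M ⊗_A N ≅ B ⊕ Q` as `B`-`B`-bimodules and `N ⊗_B M ≅ A ⊕ P` as `A`-`A`-bimodules
with finitely generated projective bimodules `Q` and `P`. The bimodules live in an arbitrary
universe `v`. -/
def StablyEquivalentOfMoritaType (F : Type u) (A : Type uA) (B : Type uB)
    [CommRing F] [Ring A] [Algebra F A] [Ring B] [Algebra F B] : Prop :=
  ∃ (M : Type v) (_ : AddCommGroup M) (_ : Module F M) (_ : Module B M) (_ : Module Aᵐᵒᵖ M)
    (_ : IsScalarTower F B M) (_ : IsScalarTower F Aᵐᵒᵖ M) (_ : SMulCommClass B Aᵐᵒᵖ M)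
    (N : Type v) (_ : AddCommGroup N) (_ : Module F N) (_ : Module A N) (_ : Module Bᵐᵒᵖ N)
    (_ : IsScalarTower F A N) (_ : IsScalarTower F Bᵐᵒᵖ N) (_ : SMulCommClass A Bᵐᵒᵖ N),
    (Module.Projective B M ∧ Module.Projective Aᵐᵒᵖ M) ∧
    (Module.Projective A N ∧ Module.Projective Bᵐᵒᵖ N) ∧
    TensorIsoRegularAddProjective F B A M N ∧
    TensorIsoRegularAddProjective F A B N M

end StableEquivalence

/-- The truncated polynomial ring `k[t]/t^r`. -/
abbrev TruncatedPolynomial (k : Type u) [CommRing k] (r : ℕ) : Type u :=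
  Polynomial k ⧸ Ideal.span {(Polynomial.X : Polynomial k) ^ r}

end

open scoped TensorProduct

set_option linter.unusedSectionVars false

/-! The obstruction lives on `A / [A, A]`, where in characteristic `p` the map `a ↦ a ^ p` is well
defined and additive (`toHH_add_pow_char`, `toHH_pow_eq_zero`). A bimodule `M` that is finitely
generated projective on the left induces, by the Hattori-Stallings trace of right multiplication, a
transfer map `A / [A, A] → B / [B, B]` which commutes with `p`-power maps (`toHH_transfer_pow`).

For a stable equivalence, the composite of the transfers along `M` and `N` is the identity plus the
transfer along a projective bimodule `P` (`toHH_transfer_transfer`), and the latter kills nilpotent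
elements (`exists_isDualBasis_transfer_eq_zero`). So if in `B` the kernels of the `p ^ l`- and `p ^
m`-power maps agree modulo commutators, then `x ^ p ^ l = 0` in `A` forces `x ^ p ^ m ∈ [A, A]`.

Take `m = r - 1` and `l = r`. On the Witt side a transvection `g` has order `p ^ r`, so `x = g - 1`
satisfies `x ^ p ^ r = 0`, while `x ^ p ^ (r - 1) = g ^ p ^ (r - 1) - 1` is not a sum of
commutators. On the polynomial side a unipotent matrix `1 + N` has `N ^ (n * r) = 0`; since `n * r ≤
p ^ (r - 1)`, its order divides `p ^ (r - 1)`, and the kernels of the `p`-power maps are already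
stable at `r - 1`. -/

/-- The additive subgroup `[R, R]` of a ring `R` generated by the commutators `ab - ba`. -/
def commutatorSpan (R : Type*) [Ring R] : AddSubgroup R :=
  AddSubgroup.closure {x | ∃ a b : R, x = a * b - b * a}

/-! ### Commutator quotients and additivity of the `p`-th power -/

section Commutators

variable {R : Type*} [Ring R]

theorem mul_sub_mul_mem_commutatorSpan (a b : R) : a * b - b * a ∈ commutatorSpan R :=
  AddSubgroup.subset_closure ⟨a, b, rfl⟩

theorem commutatorSpan_le_of_forall {S : AddSubgroup R} (h : ∀ a b : R, a * b - b * a ∈ S) :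
    commutatorSpan R ≤ S :=
  (AddSubgroup.closure_le S).2 fun _ ⟨a, b, hx⟩ => hx ▸ h a b

theorem commutatorSpan_le_ker {Q : Type*} [AddCommGroup Q] (φ : R →+ Q)
    (h : ∀ a b : R, φ (a * b) = φ (b * a)) : commutatorSpan R ≤ φ.ker :=
  commutatorSpan_le_of_forall fun a b => by
    rw [AddMonoidHom.mem_ker, map_sub, h, sub_self]

/-- The quotient map `R → R / [R, R]`. -/
abbrev toHH (R : Type*) [Ring R] : R →+ R ⧸ commutatorSpan R :=
  QuotientAddGroup.mk' (commutatorSpan R)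

theorem toHH_eq_zero {x : R} : toHH R x = 0 ↔ x ∈ commutatorSpan R :=
  QuotientAddGroup.eq_zero_iff x

theorem toHH_mul_comm (a b : R) : toHH R (a * b) = toHH R (b * a) := by
  rw [← sub_eq_zero, ← map_sub, toHH_eq_zero]
  exact mul_sub_mul_mem_commutatorSpan a b

open Polynomial

/-- The variable is central, so each coefficient of `ab - ba` regroups into commutators of
coefficients. -/
theorem coeff_mem_commutatorSpan {f : R[X]} (hf : f ∈ commutatorSpan R[X]) (i : ℕ) :
    f.coeff i ∈ commutatorSpan R := by
  have h : commutatorSpan R[X] ≤ (commutatorSpan R).comap (lcoeff R i).toAddMonoidHom := by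
    refine commutatorSpan_le_of_forall fun a b => ?_
    change (a * b - b * a).coeff i ∈ commutatorSpan R
    rw [coeff_sub, coeff_mul, coeff_mul, ← Finset.Nat.sum_antidiagonal_swap (n := i)
      (f := fun x => b.coeff x.1 * a.coeff x.2), ← Finset.sum_sub_distrib]
    exact sum_mem fun x _ => mul_sub_mul_mem_commutatorSpan _ _
  exact h hf

/-- Modulo commutators factors may be cycled, so the usual power rule holds. The extra factor `f ^
k` absorbs the power of `f` cycled past the derivative in the induction. -/
theorem toHH_derivative_pow_mul_pow (f : R[X]) (n k : ℕ) :
    toHH R[X] (derivative (f ^ n) * f ^ k) = n • toHH R[X] (f ^ (n - 1 + k) * derivative f) := by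
  induction n generalizing k with
  | zero => simp
  | succ n ih =>
    have h1 : f ^ n * derivative f * f ^ k = f ^ n * (derivative f * f ^ k) := mul_assoc _ _ _
    rw [pow_succ, derivative_mul, add_mul, map_add, mul_assoc, ← pow_succ', ih, h1,
      toHH_mul_comm (f ^ n), mul_assoc, toHH_mul_comm (derivative f), ← pow_add, Nat.add_comm k n]
    -- The exponent `n - 1` is truncated at `n = 0`, hence the split.
    rcases n with _ | n
    · simp
    · rw [succ_nsmul _ (n + 1), show n + 1 - 1 + (k + 1) = n + 1 + 1 - 1 + k by omega,
        show n + 1 + 1 - 1 + k = n + 1 + k by omega]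

/-- By the power rule the derivative of `(a + bX) ^ p` vanishes modulo commutators, so `i` times its
`i`-th coefficient does too. For `0 < i < p` the factor `i` is invertible modulo `p`, which leaves
only the end coefficients `a ^ p` and `b ^ p`; then set `X = 1`. -/
theorem toHH_add_pow_char {p : ℕ} (hp : p.Prime) (hpR : (p : R) = 0) (a b : R) :
    toHH R ((a + b) ^ p) = toHH R (a ^ p) + toHH R (b ^ p) := by
  set f : R[X] := (C a + C b * X) ^ p with hf
  have hder : derivative f ∈ commutatorSpan R[X] := by
    have := toHH_derivative_pow_mul_pow (C a + C b * X) p 0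
    rw [pow_zero, mul_one, ← map_nsmul, nsmul_eq_mul] at this
    have hp' : (p : R[X]) = 0 := by rw [← C_eq_natCast, hpR, C_0]
    rwa [hp', zero_mul, map_zero, toHH_eq_zero] at this
  have hcoeff : ∀ i ∈ Finset.Ico 1 p, toHH R (f.coeff i) = 0 := by
    intro i hi
    rw [Finset.mem_Ico] at hi
    have h1 := coeff_mem_commutatorSpan hder (i - 1)
    rw [coeff_derivative, ← toHH_eq_zero] at h1
    have h2 : i • toHH R (f.coeff i) = 0 := by
      rw [← map_nsmul, nsmul_eq_mul, Nat.cast_comm]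
      convert h1 using 3
      · congr 1; omega
      · rw [← Nat.cast_succ]; congr 1; omega
    have h3 : p • toHH R (f.coeff i) = 0 := by
      rw [← map_nsmul, nsmul_eq_mul, hpR, zero_mul, map_zero]
    have h4 := Nat.dvd_gcd (addOrderOf_dvd_of_nsmul_eq_zero h2)
      (addOrderOf_dvd_of_nsmul_eq_zero h3)
    rw [Nat.gcd_comm, Nat.coprime_of_lt_prime (by omega) hi.2 hp, Nat.dvd_one,
      AddMonoid.addOrderOf_eq_one_iff] at h4
    exact h4
  have hdeg : f.natDegree < p + 1 := by
    refine Nat.lt_succ_of_le (natDegree_pow_le.trans ?_)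
    calc p * (C a + C b * X).natDegree ≤ p * 1 := by
          refine Nat.mul_le_mul_left p ?_
          rw [add_comm]; exact natDegree_linear_le
      _ = p := mul_one p
  -- Evaluation is multiplicative only at central elements; just `0` and `1` are needed.
  let ev : ∀ x : R, (∀ r : R, Commute r x) → R[X] →+* R := fun x hx =>
    eval₂RingHom' (RingHom.id R) x hx
  have hev1 : (a + b) ^ p = ∑ i ∈ Finset.range (p + 1), f.coeff i := by
    have : ev 1 (fun r => Commute.one_right r) f = (a + b) ^ p := by
      rw [hf, map_pow]; congr 1; simp [ev, eval₂RingHom']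
    rw [← this]
    change eval₂ (RingHom.id R) 1 f = _
    rw [eval₂_eq_sum_range' _ hdeg]; simp
  have h0 : f.coeff 0 = a ^ p := by
    have : ev 0 (fun r => Commute.zero_right r) f = a ^ p := by
      rw [hf, map_pow]; congr 1; simp [ev, eval₂RingHom']
    rw [← this]
    change _ = eval₂ (RingHom.id R) 0 f
    rw [eval₂_at_zero]; rfl
  have hp1 : f.coeff p = b ^ p := by
    have := coeff_pow_of_natDegree_le (p := C a + C b * X) (n := 1) (m := p)
      (by rw [add_comm]; exact natDegree_linear_le)
    simpa using this
  rw [hev1, Finset.sum_range_succ, map_add, hp1, Finset.range_eq_Ico,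
    Finset.sum_eq_sum_Ico_succ_bot hp.pos, map_add, map_sum, Finset.sum_eq_zero hcoeff, h0,
    add_zero]

end Commutators

/-! ### The `p`-power maps on `R / [R, R]` and matrix traces -/

section Frobenius

variable {R : Type*} [Ring R] {p : ℕ}

/-- In characteristic `p`, the additive map `R → R / [R, R]`, `a ↦ a ^ p`. -/
def frobHHOne (hp : p.Prime) (hpR : (p : R) = 0) : R →+ R ⧸ commutatorSpan R where
  toFun a := toHH R (a ^ p)
  map_zero' := by rw [zero_pow hp.ne_zero, map_zero]
  map_add' := toHH_add_pow_char hp hpR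

/-- By additivity it suffices to compare `(ab) ^ p = a (ba) ^ (p - 1) b` with `(ba) ^ p`, which
agree after cycling `a`. -/
theorem toHH_pow_eq_zero (hp : p.Prime) (hpR : (p : R) = 0) {x : R}
    (hx : x ∈ commutatorSpan R) : toHH R (x ^ p) = 0 := by
  refine commutatorSpan_le_ker (frobHHOne hp hpR) (fun a b => ?_) hx
  change toHH R ((a * b) ^ p) = toHH R ((b * a) ^ p)
  obtain ⟨n, hn⟩ := Nat.exists_eq_succ_of_ne_zero hp.ne_zero
  rw [hn, Nat.succ_eq_add_one, pow_succ, ← mul_assoc, toHH_mul_comm, mul_pow_mul,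
    ← mul_assoc, ← pow_succ']

theorem toHH_pow_congr (hp : p.Prime) (hpR : (p : R) = 0) {x y : R}
    (h : toHH R x = toHH R y) : toHH R (x ^ p) = toHH R (y ^ p) := by
  have h1 : x - y ∈ commutatorSpan R := by rw [← toHH_eq_zero, map_sub, h, sub_self]
  rw [← sub_add_cancel x y, toHH_add_pow_char hp hpR, toHH_pow_eq_zero hp hpR h1, zero_add]

theorem toHH_pow_pow_congr (hp : p.Prime) (hpR : (p : R) = 0) {x y : R}
    (h : toHH R x = toHH R y) (k : ℕ) : toHH R (x ^ p ^ k) = toHH R (y ^ p ^ k) := by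
  induction k with
  | zero => simpa using h
  | succ k ih => rw [pow_succ, pow_mul, pow_mul]; exact toHH_pow_congr hp hpR ih

/-- In characteristic `p`, the additive map `R → R / [R, R]`, `a ↦ a ^ (p ^ k)`. -/
def frobHH (hp : p.Prime) (hpR : (p : R) = 0) (k : ℕ) : R →+ R ⧸ commutatorSpan R where
  toFun a := toHH R (a ^ p ^ k)
  map_zero' := by rw [zero_pow (pow_pos hp.pos k).ne', map_zero]
  map_add' a b := by
    induction k with
    | zero => simp
    | succ k ih =>
      simp only [pow_succ p, pow_mul]
      rw [← toHH_add_pow_char hp hpR]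
      exact toHH_pow_congr hp hpR (by rw [ih, map_add])

theorem frobHH_apply (hp : p.Prime) (hpR : (p : R) = 0) (k : ℕ) (a : R) :
    frobHH hp hpR k a = toHH R (a ^ p ^ k) := rfl

/-- The trace of matrices, with values in `R / [R, R]`. -/
def traceHH (ι R : Type*) [Fintype ι] [Ring R] : Matrix ι ι R →+ R ⧸ commutatorSpan R :=
  (toHH R).comp (Matrix.traceAddMonoidHom ι R)

theorem traceHH_mul_comm {ι : Type*} [Fintype ι] [DecidableEq ι] (X Y : Matrix ι ι R) :
    traceHH ι R (X * Y) = traceHH ι R (Y * X) := by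
  simp only [traceHH, AddMonoidHom.comp_apply, Matrix.traceAddMonoidHom_apply, Matrix.trace,
    Matrix.diag, Matrix.mul_apply, map_sum]
  rw [Finset.sum_comm]
  exact Finset.sum_congr rfl fun i _ => Finset.sum_congr rfl fun j _ => toHH_mul_comm _ _

theorem traceHH_single_pow {ι : Type*} [Fintype ι] [DecidableEq ι] (i j : ι) (x : R) {n : ℕ}
    (hn : 0 < n) :
    traceHH ι R (Matrix.single i j x ^ n) = if i = j then toHH R (x ^ n) else 0 := by
  obtain ⟨n, rfl⟩ := Nat.exists_eq_add_of_lt hn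
  rw [zero_add]
  split_ifs with h
  · subst h
    have : Matrix.single i i x ^ (n + 1) = Matrix.single i i (x ^ (n + 1)) := by
      induction n with
      | zero => simp
      | succ n ih => rw [pow_succ, ih (by omega), Matrix.single_mul_single_same, ← pow_succ]
    rw [this]
    simp [traceHH, Matrix.trace_single_eq_same]
  · rcases n with _ | n
    · simp [traceHH, Matrix.trace_single_eq_of_ne _ _ _ h]
    · rw [pow_succ, pow_succ, mul_assoc, Matrix.single_mul_single_of_ne _ _ _ _ (Ne.symm h),
        mul_zero, map_zero]

/-- Both sides are additive in `X`, the left one by Frobenius additivity in the matrix ring itself,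
so matrices with a single nonzero entry suffice. -/
theorem traceHH_pow {ι : Type*} [Fintype ι] [DecidableEq ι] (hp : p.Prime)
    (hpR : (p : R) = 0) (X : Matrix ι ι R) (k : ℕ) :
    traceHH ι R (X ^ p ^ k) = toHH R (X.trace ^ p ^ k) := by
  have hpM : (p : Matrix ι ι R) = 0 := by
    rw [← Matrix.diagonal_natCast, hpR, Matrix.diagonal_zero]
  let τ : Matrix ι ι R ⧸ commutatorSpan (Matrix ι ι R) →+ R ⧸ commutatorSpan R :=
    QuotientAddGroup.lift _ (traceHH ι R) (commutatorSpan_le_ker _ traceHH_mul_comm)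
  have hτ : ∀ Y, τ (frobHH hp hpM k Y) = traceHH ι R (Y ^ p ^ k) := fun Y => rfl
  rw [← hτ]
  conv_lhs => rw [Matrix.matrix_eq_sum_single X]
  simp only [map_sum, hτ, traceHH_single_pow _ _ _ (pow_pos hp.pos k), Finset.sum_ite_eq,
    Finset.mem_univ, if_true]
  rw [Matrix.trace, ← frobHH_apply hp hpR, map_sum]
  rfl

end Frobenius

/-! ### Dual bases and the Hattori-Stallings trace -/

/-- `m` and `f` form a dual basis of the left `R`-module `M`. -/
def IsDualBasis {R M ι : Type*} [Ring R] [AddCommGroup M] [Module R M] [Fintype ι]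
    (m : ι → M) (f : ι → M →ₗ[R] R) : Prop :=
  ∀ x, ∑ i, f i x • m i = x

section DualBasis

variable {R M ι κ : Type*} [Ring R] [AddCommGroup M] [Module R M] [Fintype ι] [Fintype κ]

theorem exists_isDualBasis (R M : Type*) [Ring R] [AddCommGroup M] [Module R M]
    [Module.Finite R M] [Module.Projective R M] :
    ∃ (n : ℕ) (m : Fin n → M) (f : Fin n → M →ₗ[R] R), IsDualBasis m f := by
  obtain ⟨n, f, g, -, -, h⟩ := Module.Finite.exists_comp_eq_id_of_projective R M
  refine ⟨n, fun i => f (Pi.single i 1), fun i => LinearMap.proj i ∘ₗ g, fun x => ?_⟩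
  have h1 : f (g x) = x := LinearMap.congr_fun h x
  conv_rhs => rw [← h1, LinearMap.pi_apply_eq_sum_univ f (g x)]
  refine Finset.sum_congr rfl fun i _ => ?_
  simp only [LinearMap.comp_apply, LinearMap.proj_apply]
  congr 2
  ext j
  simp [Pi.single_apply, eq_comm]

namespace IsDualBasis

variable {m : ι → M} {f : ι → M →ₗ[R] R}

/-- The Hattori-Stallings trace does not depend on the dual basis. -/
theorem toHH_trace_eq (h : IsDualBasis m f) {n : κ → M} {g : κ → M →ₗ[R] R}
    (h' : IsDualBasis n g) (u : M →ₗ[R] M) :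
    toHH R (∑ i, f i (u (m i))) = toHH R (∑ j, g j (u (n j))) := by
  calc toHH R (∑ i, f i (u (m i)))
      = toHH R (∑ i, ∑ j, g j (m i) * f i (u (n j))) := by
        congr 1
        refine Finset.sum_congr rfl fun i _ => ?_
        conv_lhs => rw [← h' (m i)]
        simp [map_sum]
    _ = toHH R (∑ j, ∑ i, f i (u (n j)) * g j (m i)) := by
        rw [Finset.sum_comm]
        simp only [map_sum]
        exact Finset.sum_congr rfl fun i _ => Finset.sum_congr rfl fun j _ => toHH_mul_comm _ _
    _ = toHH R (∑ j, g j (u (n j))) := by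
        congr 1
        refine Finset.sum_congr rfl fun j _ => ?_
        conv_rhs => rw [← h (u (n j))]
        simp [map_sum]

theorem prod (h : IsDualBasis m f) {M' : Type*} [AddCommGroup M'] [Module R M']
    {n : κ → M'} {g : κ → M' →ₗ[R] R} (h' : IsDualBasis n g) :
    IsDualBasis (Sum.elim (fun i => (m i, (0 : M'))) fun j => ((0 : M), n j))
      (Sum.elim (fun i => f i ∘ₗ LinearMap.fst R M M') fun j => g j ∘ₗ LinearMap.snd R M M') := by
  rintro ⟨x, y⟩
  rw [Fintype.sum_sum_type]
  ext
  · simp [Prod.fst_sum, h x]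
  · simp [Prod.snd_sum, h' y]

theorem ring (R : Type*) [Ring R] :
    IsDualBasis (fun _ : Unit => (1 : R)) (fun _ => LinearMap.id (R := R)) := by
  intro x; simp

/-- The matrix of an endomorphism with respect to a dual basis. -/
def toMatrix (m : ι → M) (f : ι → M →ₗ[R] R) (u : M →ₗ[R] M) : Matrix ι ι R :=
  Matrix.of fun i j => f j (u (m i))

/-- Positivity of `n` matters: the identity endomorphism only gives an idempotent matrix. -/
theorem toMatrix_pow [DecidableEq ι] (h : IsDualBasis m f) (u : Module.End R M) {n : ℕ}
    (hn : 0 < n) : toMatrix m f (u ^ n) = toMatrix m f u ^ n := by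
  obtain ⟨n, rfl⟩ := Nat.exists_eq_add_of_lt hn
  rw [zero_add]
  clear hn
  induction n with
  | zero => simp
  | succ n ih =>
    rw [pow_succ (toMatrix m f u), ← ih]
    ext i j
    rw [Matrix.mul_apply, toMatrix, Matrix.of_apply, pow_succ', Module.End.mul_apply]
    conv_lhs => rw [← h ((u ^ (n + 1)) (m i))]
    simp [toMatrix, map_sum]

/-- In characteristic `p`, the Hattori-Stallings trace commutes with `p`-power maps. -/
theorem toHH_trace_pow (h : IsDualBasis m f) {p : ℕ} (hp : p.Prime) (hpR : (p : R) = 0)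
    (u : Module.End R M) (k : ℕ) :
    toHH R (∑ i, f i ((u ^ p ^ k) (m i))) = toHH R ((∑ i, f i (u (m i))) ^ p ^ k) := by
  classical
  have := traceHH_pow hp hpR (toMatrix m f u) k
  rwa [← h.toMatrix_pow u (pow_pos hp.pos k)] at this

theorem toHH_trace_mul_comm (h : IsDualBasis m f) (u v : Module.End R M) :
    toHH R (∑ i, f i ((u * v) (m i))) = toHH R (∑ i, f i ((v * u) (m i))) := by
  have key : ∀ u v : Module.End R M,
      ∑ i, f i ((u * v) (m i)) = ∑ i, ∑ j, f j (v (m i)) * f i (u (m j)) := fun u v => by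
    refine Finset.sum_congr rfl fun i _ => ?_
    rw [Module.End.mul_apply]
    conv_lhs => rw [← h (v (m i))]
    simp [map_sum]
  rw [key, key, Finset.sum_comm]
  simp only [map_sum]
  exact Finset.sum_congr rfl fun i _ => Finset.sum_congr rfl fun j _ => toHH_mul_comm _ _

end IsDualBasis

end DualBasis

/-! ### Transfer maps attached to bimodules -/

section Transfer

variable {A B M ι : Type*} [Ring A] [Ring B] [AddCommGroup M] [Module B M] [Module Aᵐᵒᵖ M]
  [SMulCommClass B Aᵐᵒᵖ M] [Fintype ι]

/-- Right multiplication by `a : A` on a `B`-`A`-bimodule. -/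
def rightMul (B M : Type*) [Ring B] [AddCommGroup M] [Module B M] [Module Aᵐᵒᵖ M]
    [SMulCommClass B Aᵐᵒᵖ M] (a : A) : Module.End B M where
  toFun x := MulOpposite.op a • x
  map_add' := smul_add _
  map_smul' b x := (smul_comm b (MulOpposite.op a) x).symm

theorem rightMul_mul (a b : A) :
    rightMul B M (a * b) = rightMul B M b * rightMul B M a := by
  ext x
  exact mul_smul (MulOpposite.op b) (MulOpposite.op a) x

theorem rightMul_pow (a : A) (n : ℕ) : rightMul B M (a ^ n) = rightMul B M a ^ n := by
  induction n with
  | zero => ext x; rw [pow_zero, pow_zero]; exact one_smul Aᵐᵒᵖ x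
  | succ n ih => rw [pow_succ, rightMul_mul, ih, ← pow_succ']

/-- The transfer map attached to a bimodule with a dual basis as a left module. -/
def transfer (A : Type*) [Ring A] [Module Aᵐᵒᵖ M] (m : ι → M) (f : ι → M →ₗ[B] B) : A →+ B where
  toFun a := ∑ i, f i (MulOpposite.op a • m i)
  map_zero' := by simp
  map_add' a b := by simp [add_smul, Finset.sum_add_distrib]

variable {m : ι → M} {f : ι → M →ₗ[B] B}

theorem transfer_apply (a : A) : transfer A m f a = ∑ i, f i (MulOpposite.op a • m i) := rfl

theorem transfer_mem_commutatorSpan (h : IsDualBasis m f) {a : A}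
    (ha : a ∈ commutatorSpan A) : transfer A m f a ∈ commutatorSpan B := by
  rw [← toHH_eq_zero]
  refine commutatorSpan_le_ker ((toHH B).comp (transfer A m f)) (fun a b => ?_) ha
  have := h.toHH_trace_mul_comm (rightMul B M b) (rightMul B M a)
  rwa [← rightMul_mul, ← rightMul_mul] at this

theorem toHH_transfer_pow (h : IsDualBasis m f) {p : ℕ} (hp : p.Prime) (hpB : (p : B) = 0)
    (a : A) (k : ℕ) :
    toHH B (transfer A m f (a ^ p ^ k)) = toHH B (transfer A m f a ^ p ^ k) := by
  have := h.toHH_trace_pow hp hpB (rightMul B M a) k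
  rwa [← rightMul_pow] at this

end Transfer

/-! ### Tensor products of bimodules and composition of transfers -/

theorem BalancedTensor.induction {F A M N : Type*} [CommRing F] [Ring A]
    [AddCommGroup M] [Module F M] [Module Aᵐᵒᵖ M] [AddCommGroup N] [Module F N] [Module A N]
    {p : BalancedTensor F A M N → Prop}
    (tmul : ∀ m n, p (BalancedTensor.tmul F A m n)) (zero : p 0)
    (add : ∀ x y, p x → p y → p (x + y)) (x : BalancedTensor F A M N) : p x := by
  obtain ⟨x, rfl⟩ := Submodule.Quotient.mk_surjective _ x
  induction x using TensorProduct.induction_on with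
  | zero => exact zero
  | tmul m n => exact tmul m n
  | add x y hx hy => exact add _ _ hx hy

theorem BalancedTensor.exists_sum {F A M N : Type*} [CommRing F] [Ring A]
    [AddCommGroup M] [Module F M] [Module Aᵐᵒᵖ M] [AddCommGroup N] [Module F N] [Module A N]
    (x : BalancedTensor F A M N) :
    ∃ (n : ℕ) (s : Fin n → M) (t : Fin n → N), x = ∑ i, BalancedTensor.tmul F A (s i) (t i) := by
  induction x using BalancedTensor.induction with
  | tmul m n => exact ⟨1, fun _ => m, fun _ => n, by simp⟩
  | zero => exact ⟨0, Fin.elim0, Fin.elim0, by simp⟩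
  | add x y hx hy =>
    obtain ⟨n, s, t, rfl⟩ := hx
    obtain ⟨n', s', t', rfl⟩ := hy
    exact ⟨n + n', Fin.append s s', Fin.append t t', by simp [Fin.sum_univ_add]⟩

/-- The linear map on `M ⊗_A N` induced by a balanced bilinear map. -/
def BalancedTensor.lift {F A M N L : Type*} [CommRing F] [Ring A]
    [AddCommGroup M] [Module F M] [Module Aᵐᵒᵖ M] [AddCommGroup N] [Module F N] [Module A N]
    [AddCommGroup L] [Module F L] (β : M →ₗ[F] N →ₗ[F] L)
    (h : ∀ (m : M) (a : A) (n : N), β (MulOpposite.op a • m) n = β m (a • n)) :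
    BalancedTensor F A M N →ₗ[F] L :=
  Submodule.liftQ _ (TensorProduct.lift β) (by
    refine Submodule.span_le.2 ?_
    rintro _ ⟨m, a, n, rfl⟩
    simp [h])

/-- The bilinear map `(m, n) ↦ m ⊗ n`. -/
def BalancedTensor.mk (F A M N : Type*) [CommRing F] [Ring A]
    [AddCommGroup M] [Module F M] [Module Aᵐᵒᵖ M] [AddCommGroup N] [Module F N] [Module A N] :
    M →ₗ[F] N →ₗ[F] BalancedTensor F A M N :=
  (TensorProduct.mk F M N).compr₂ (balancedRelations F A M N).mkQ

theorem BalancedTensor.mk_apply {F A M N : Type*} [CommRing F] [Ring A]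
    [AddCommGroup M] [Module F M] [Module Aᵐᵒᵖ M] [AddCommGroup N] [Module F N] [Module A N]
    (m : M) (n : N) : BalancedTensor.mk F A M N m n = BalancedTensor.tmul F A m n := rfl

theorem BalancedTensor.smul_tmul {F A M N : Type*} [CommRing F] [Ring A]
    [AddCommGroup M] [Module F M] [Module Aᵐᵒᵖ M] [AddCommGroup N] [Module F N] [Module A N]
    (m : M) (a : A) (n : N) :
    BalancedTensor.tmul F A (MulOpposite.op a • m) n = BalancedTensor.tmul F A m (a • n) :=
  (Submodule.Quotient.eq _).2 (Submodule.subset_span ⟨m, a, n, rfl⟩)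

section Balanced

variable {F : Type u} {A : Type uA} {B : Type uB} {M N : Type v} {ι κ : Type*}
  [CommRing F] [Ring A] [Algebra F A] [Ring B] [Algebra F B]
  [AddCommGroup M] [Module F M] [Module B M] [Module Aᵐᵒᵖ M]
  [IsScalarTower F B M] [IsScalarTower F Aᵐᵒᵖ M] [SMulCommClass B Aᵐᵒᵖ M]
  [AddCommGroup N] [Module F N] [Module A N] [Module Bᵐᵒᵖ N]
  [IsScalarTower F A N] [IsScalarTower F Bᵐᵒᵖ N] [SMulCommClass A Bᵐᵒᵖ N]
  [Fintype ι] [Fintype κ]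

/-- For functionals `f` on `M` and `g` on `N`, the map `n ⊗ m ↦ g (n f(m))` on `N ⊗_B M`. -/
def BalancedTensor.functional (f : M →ₗ[B] B) (g : N →ₗ[A] A) :
    BalancedTensor F B N M →ₗ[F] A :=
  BalancedTensor.lift
    (LinearMap.mk₂ F (fun n m => g (MulOpposite.op (f m) • n))
      (fun n n' m => by simp)
      (fun c n m => by
        rw [smul_comm, g.map_smul_of_tower])
      (fun n m m' => by simp [add_smul])
      (fun c n m => by
        rw [f.map_smul_of_tower, MulOpposite.op_smul, smul_assoc, g.map_smul_of_tower]))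
    (fun n b m => by simp [mul_smul])

theorem BalancedTensor.functional_tmul (f : M →ₗ[B] B) (g : N →ₗ[A] A) (n : N) (m : M) :
    BalancedTensor.functional (F := F) f g (BalancedTensor.tmul F B n m)
      = g (MulOpposite.op (f m) • n) := rfl

theorem BalancedTensor.functional_left (f : M →ₗ[B] B) (g : N →ₗ[A] A) (a : A)
    (x : BalancedTensor F B N M) :
    BalancedTensor.functional (F := F) f g (BalancedTensor.left F B N M a x)
      = a * BalancedTensor.functional (F := F) f g x := by
  induction x using BalancedTensor.induction with
  | tmul n m =>
    rw [BalancedTensor.left_tmul, functional_tmul, functional_tmul, ← smul_comm, map_smul,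
      smul_eq_mul]
  | zero => simp
  | add x y hx hy => simp only [map_add, hx, hy, mul_add]

/-- The elements `n_j ⊗ m_i` with these functionals form a dual basis of `N ⊗_B M`: expand `m` over
`B`, move the coefficient across the tensor sign, then expand over `A`. -/
theorem BalancedTensor.sum_functional {m : ι → M} {f : ι → M →ₗ[B] B} (hm : IsDualBasis m f)
    {n : κ → N} {g : κ → N →ₗ[A] A} (hn : IsDualBasis n g) (x : BalancedTensor F B N M) :
    ∑ ij : ι × κ, BalancedTensor.left F B N M
      (BalancedTensor.functional (F := F) (f ij.1) (g ij.2) x)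
      (BalancedTensor.tmul F B (n ij.2) (m ij.1)) = x := by
  induction x using BalancedTensor.induction with
  | tmul y x =>
    simp only [functional_tmul, BalancedTensor.left_tmul, Fintype.sum_prod_type]
    have h1 : ∀ i, ∑ j, BalancedTensor.tmul F B (g j (MulOpposite.op (f i x) • y) • n j) (m i)
        = BalancedTensor.tmul F B y (f i x • m i) := fun i => by
      rw [← BalancedTensor.smul_tmul]
      conv_rhs => rw [← hn (MulOpposite.op (f i x) • y)]
      simp only [← BalancedTensor.mk_apply, map_sum, LinearMap.sum_apply]
    simp only [h1]
    conv_rhs => rw [← hm x]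
    simp only [← BalancedTensor.mk_apply, map_sum]
  | zero => simp [BalancedTensor.left]
  | add x y hx hy =>
    have hadd : ∀ (a b : A) (t : BalancedTensor F B N M), BalancedTensor.left F B N M (a + b) t
        = BalancedTensor.left F B N M a t + BalancedTensor.left F B N M b t := fun a b t => by
      induction t using BalancedTensor.induction with
      | tmul n m =>
        rw [BalancedTensor.left_tmul, BalancedTensor.left_tmul, BalancedTensor.left_tmul, add_smul,
          ← BalancedTensor.mk_apply, map_add]
        rfl
      | zero => simp
      | add x y hx hy => simp only [map_add, hx, hy]; abel
    simp only [map_add, hadd, Finset.sum_add_distrib, hx, hy]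

/-- The transfer along `N ⊗_B M ≅ A ⊕ P` is the composite of the transfers along `M` and `N`. -/
theorem toHH_transfer_transfer {m : ι → M} {f : ι → M →ₗ[B] B} (hm : IsDualBasis m f)
    {n : κ → N} {g : κ → N →ₗ[A] A} (hn : IsDualBasis n g)
    {P : Type v} [AddCommGroup P] [Module F P] [Module A P] [Module Aᵐᵒᵖ P]
    [SMulCommClass A Aᵐᵒᵖ P]
    (e : BalancedTensor F B N M ≃ₗ[F] A × P)
    (hl : ∀ (a : A) (x : BalancedTensor F B N M), e (BalancedTensor.left F B N M a x) = a • e x)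
    (hr : ∀ (a : A) (x : BalancedTensor F B N M),
      e (BalancedTensor.right F B N M a x) = MulOpposite.op a • e x)
    {τ : Type*} [Fintype τ] {q : τ → P} {h : τ → P →ₗ[A] A} (hq : IsDualBasis q h) (a : A) :
    toHH A (transfer B n g (transfer A m f a)) = toHH A a + toHH A (transfer A q h a) := by
  have hl' : ∀ (a : A) (x : A × P), e.symm (a • x) = BalancedTensor.left F B N M a (e.symm x) :=
    fun a x => by rw [LinearEquiv.symm_apply_eq, hl, LinearEquiv.apply_symm_apply]
  let Φ : ι × κ → (A × P) →ₗ[A] A := fun ij =>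
    { toFun := fun x => BalancedTensor.functional (F := F) (f ij.1) (g ij.2) (e.symm x)
      map_add' := fun x y => by rw [map_add, map_add]
      map_smul' := fun a x => by
        rw [hl', BalancedTensor.functional_left]; rfl }
  -- The product dual basis, transported along `e`, is to be compared with the one made of `(1, 0)`
  -- and the `(0, q j)`.
  have hΦ : IsDualBasis (fun ij : ι × κ => e (BalancedTensor.tmul F B (n ij.2) (m ij.1))) Φ := by
    intro x
    have := congrArg e (BalancedTensor.sum_functional hm hn (e.symm x))
    rw [LinearEquiv.apply_symm_apply, map_sum] at this
    simp only [hl] at this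
    exact this
  have key := hΦ.toHH_trace_eq ((IsDualBasis.ring A).prod hq) (rightMul A (A × P) a)
  have h1 : ∑ ij, Φ ij (rightMul A (A × P) a (e (BalancedTensor.tmul F B (n ij.2) (m ij.1))))
      = transfer B n g (transfer A m f a) := by
    have h2 : ∀ ij, Φ ij (rightMul A (A × P) a (e (BalancedTensor.tmul F B (n ij.2) (m ij.1))))
        = g ij.2 (MulOpposite.op (f ij.1 (MulOpposite.op a • m ij.1)) • n ij.2) := fun ij => by
      change BalancedTensor.functional (F := F) (f ij.1) (g ij.2) (e.symm (MulOpposite.op a • _)) = _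
      rw [← hr, LinearEquiv.symm_apply_apply, BalancedTensor.right_tmul,
        BalancedTensor.functional_tmul]
    simp only [h2, Fintype.sum_prod_type, transfer_apply]
    rw [Finset.sum_comm]
    refine Finset.sum_congr rfl fun j _ => ?_
    rw [← map_sum, ← Finset.sum_smul, Finset.op_sum]
  have h2 : ∑ i : Unit ⊕ τ, (Sum.elim (fun _ : Unit => LinearMap.id (R := A) ∘ₗ LinearMap.fst A A P)
        (fun j => h j ∘ₗ LinearMap.snd A A P)) i (rightMul A (A × P) a
          ((Sum.elim (fun _ : Unit => ((1 : A), (0 : P))) fun j => ((0 : A), q j)) i))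
      = a + transfer A q h a := by
    rw [Fintype.sum_sum_type]
    simp [rightMul, transfer_apply]
  rw [h1, h2, map_add] at key
  exact key

end Balanced

/-! ### Finite dimensionality of the bimodules of a stable equivalence -/

section Finiteness

variable {F : Type u} {A : Type uA} {B : Type uB} {M N : Type v}
  [Field F] [Ring A] [Algebra F A] [Ring B] [Algebra F B]
  [AddCommGroup M] [Module F M] [Module B M] [Module Aᵐᵒᵖ M]
  [IsScalarTower F B M] [IsScalarTower F Aᵐᵒᵖ M] [SMulCommClass B Aᵐᵒᵖ M]
  [AddCommGroup N] [Module F N] [Module A N] [Module Bᵐᵒᵖ N]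
  [IsScalarTower F A N] [IsScalarTower F Bᵐᵒᵖ N] [SMulCommClass A Bᵐᵒᵖ N]
  {P : Type v} [AddCommGroup P] [Module F P] [Module A P] [Module Aᵐᵒᵖ P]

/-- Finiteness of `M` is not part of the definition of stable equivalence. Writing `1 ∈ A` as the
image of `∑ s_j ⊗ t_j` makes `M` an `F`-linear retract of a finite power of `M ⊗_A N`, via `x ↦ (x ⊗
s_j)` and `m ⊗ n ↦ m α_j(n)`. -/
theorem finite_left_of_balancedTensor [Module.Finite F (BalancedTensor F A M N)]
    (e : BalancedTensor F B N M ≃ₗ[F] A × P)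
    (hl : ∀ (a : A) (x : BalancedTensor F B N M),
      e (BalancedTensor.left F B N M a x) = a • e x) : Module.Finite F M := by
  obtain ⟨k, s, t, hst⟩ := BalancedTensor.exists_sum (e.symm (1, 0))
  let α : Fin k → N →ₗ[F] A := fun j =>
    LinearMap.fst F A P ∘ₗ e.toLinearMap ∘ₗ (BalancedTensor.mk F B N M).flip (t j)
  have hα : ∀ j a n, α j (a • n) = a * α j n := fun j a n => by
    change (e (BalancedTensor.tmul F B (a • n) (t j))).1 = a * (e (BalancedTensor.tmul F B n (t j))).1
    rw [← BalancedTensor.left_tmul, hl]; rfl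
  have hsum : ∑ j, α j (s j) = 1 := by
    have := congrArg (fun x => (e x).1) hst
    simp only [LinearEquiv.apply_symm_apply, map_sum, Prod.fst_sum] at this
    exact this.symm
  let ψ : Fin k → BalancedTensor F A M N →ₗ[F] M := fun j => BalancedTensor.lift
    (LinearMap.mk₂ F (fun m n => MulOpposite.op (α j n) • m)
      (fun m m' n => by simp) (fun c m n => smul_comm _ _ _)
      (fun m n n' => by simp [add_smul]) (fun c m n => by
        rw [map_smul, MulOpposite.op_smul, smul_assoc]))
    (fun m a n => by simp [hα, mul_smul])
  let φ : M →ₗ[F] (Fin k → BalancedTensor F A M N) :=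
    LinearMap.pi fun j => (BalancedTensor.mk F A M N).flip (s j)
  refine Module.Finite.of_injective φ (Function.LeftInverse.injective (g := fun y => ∑ j, ψ j (y j))
    fun x => ?_)
  change ∑ j, MulOpposite.op (α j (s j)) • x = x
  rw [← Finset.sum_smul, ← Finset.op_sum, hsum, MulOpposite.op_one, one_smul]

theorem finite_right_of_balancedTensor [Module.Finite F (BalancedTensor F A M N)]
    (e : BalancedTensor F B N M ≃ₗ[F] A × P)
    (hr : ∀ (a : A) (x : BalancedTensor F B N M),
      e (BalancedTensor.right F B N M a x) = MulOpposite.op a • e x) : Module.Finite F N := by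
  obtain ⟨k, s, t, hst⟩ := BalancedTensor.exists_sum (e.symm (1, 0))
  let α : Fin k → M →ₗ[F] A := fun j =>
    LinearMap.fst F A P ∘ₗ e.toLinearMap ∘ₗ (BalancedTensor.mk F B N M) (s j)
  have hα : ∀ j a m, α j (MulOpposite.op a • m) = α j m * a := fun j a m => by
    change (e (BalancedTensor.tmul F B (s j) (MulOpposite.op a • m))).1
      = (e (BalancedTensor.tmul F B (s j) m)).1 * a
    rw [← BalancedTensor.right_tmul, hr]; rfl
  have hsum : ∑ j, α j (t j) = 1 := by
    have := congrArg (fun x => (e x).1) hst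
    simp only [LinearEquiv.apply_symm_apply, map_sum, Prod.fst_sum] at this
    exact this.symm
  let ψ : Fin k → BalancedTensor F A M N →ₗ[F] N := fun j => BalancedTensor.lift
    (LinearMap.mk₂ F (fun m n => α j m • n)
      (fun m m' n => by simp [add_smul]) (fun c m n => by rw [map_smul, smul_assoc])
      (fun m n n' => by simp) (fun c m n => smul_comm _ _ _))
    (fun m a n => by simp [hα, mul_smul])
  let φ : N →ₗ[F] (Fin k → BalancedTensor F A M N) :=
    LinearMap.pi fun j => (BalancedTensor.mk F A M N) (t j)
  refine Module.Finite.of_injective φ (Function.LeftInverse.injective (g := fun y => ∑ j, ψ j (y j))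
    fun x => ?_)
  change ∑ j, α j (t j) • x = x
  rw [← Finset.sum_smul, hsum, one_smul]

end Finiteness

/-! ### Transfer along a projective bimodule kills nilpotents -/

section BimoduleTrace

attribute [local instance] TensorProduct.Algebra.module

variable {F A P : Type*} [Field F] [Ring A] [Algebra F A]
  [AddCommGroup P] [Module F P] [Module A P] [Module Aᵐᵒᵖ P]
  [IsScalarTower F A P] [IsScalarTower F Aᵐᵒᵖ P] [SMulCommClass A Aᵐᵒᵖ P]

/-- The sum is the `F`-trace of `x ↦ y x z`, which is nilpotent because left and right
multiplications commute. -/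
theorem sum_repr_mul_mul_eq_zero {κ : Type*} [Fintype κ] (w : Module.Basis κ F A) (y : A) {z : A}
    (hz : IsNilpotent z) : ∑ s, w.repr (y * (w s * z)) s = 0 := by
  classical
  have := Module.Finite.of_basis w
  have h1 : IsNilpotent (LinearMap.mulLeft F y ∘ₗ LinearMap.mulRight F z) := by
    have hc : Commute (LinearMap.mulLeft F y) (LinearMap.mulRight F z) :=
      LinearMap.commute_mulLeft_right y z
    refine hc.isNilpotent_mul_left ?_
    obtain ⟨n, hn⟩ := hz
    exact ⟨n, by rw [LinearMap.pow_mulRight, hn, LinearMap.mulRight_zero_eq_zero]⟩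
  have h2 := (LinearMap.isNilpotent_trace_of_isNilpotent h1).eq_zero
  rw [LinearMap.trace_eq_matrix_trace F w] at h2
  simpa [Matrix.trace, LinearMap.toMatrix_apply] using h2

theorem isScalarTower_tensor_mop : IsScalarTower F (A ⊗[F] Aᵐᵒᵖ) P := by
  refine ⟨fun c x q => ?_⟩
  induction x using TensorProduct.induction_on with
  | zero =>
    have h0 : (0 : A ⊗[F] Aᵐᵒᵖ) • q = 0 := zero_smul (A ⊗[F] Aᵐᵒᵖ) q
    rw [smul_zero, h0, smul_zero]
  | tmul a b =>
    rw [TensorProduct.smul_tmul', TensorProduct.Algebra.smul_def, TensorProduct.Algebra.smul_def,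
      smul_assoc]
  | add x y hx hy => rw [smul_add, add_smul, add_smul, smul_add, hx, hy]

/-- The left linear functional `x ⊗ y ↦ w_s^*(y) x` on `A ⊗ Aᵒᵖ`. -/
noncomputable def coordTensor {κ : Type*} (w : Module.Basis κ F A) (s : κ) : A ⊗[F] Aᵐᵒᵖ →ₗ[A] A :=
  (TensorProduct.AlgebraTensorModule.rid F A A).toLinearMap ∘ₗ
    TensorProduct.AlgebraTensorModule.map LinearMap.id
      (w.coord s ∘ₗ (MulOpposite.opLinearEquiv F).symm.toLinearMap)

theorem coordTensor_tmul {κ : Type*} (w : Module.Basis κ F A) (s : κ) (x y : A) :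
    coordTensor w s (x ⊗ₜ[F] MulOpposite.op y) = w.repr y s • x := by
  simp [coordTensor]

/-- A finitely generated projective bimodule has a dual basis as a left module such that the
transfer map vanishes on nilpotent elements. -/
theorem exists_isDualBasis_transfer_eq_zero [Module.Finite F A]
    [Module.Finite (A ⊗[F] Aᵐᵒᵖ) P] [Module.Projective (A ⊗[F] Aᵐᵒᵖ) P] :
    ∃ (n : ℕ) (q : Fin n × Fin (Module.finrank F A) → P)
      (h : Fin n × Fin (Module.finrank F A) → P →ₗ[A] A), IsDualBasis q h ∧
        ∀ z : A, IsNilpotent z → transfer A q h z = 0 := by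
  obtain ⟨n, q, f, hf⟩ := exists_isDualBasis (A ⊗[F] Aᵐᵒᵖ) P
  let w := Module.finBasis F A
  have hleft : ∀ (a : A) (x : P), a • x = (a ⊗ₜ[F] (1 : Aᵐᵒᵖ)) • x := fun a x => by
    rw [TensorProduct.Algebra.smul_def, one_smul]
  have hright : ∀ (a : A) (x : P), MulOpposite.op a • x
      = ((1 : A) ⊗ₜ[F] MulOpposite.op a) • x := fun a x => by
    rw [TensorProduct.Algebra.smul_def, one_smul]
  have hsmul : ∀ (a : A) (t : A ⊗[F] Aᵐᵒᵖ), (a ⊗ₜ[F] (1 : Aᵐᵒᵖ)) * t = a • t := fun a t => by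
    induction t using TensorProduct.induction_on with
    | zero => simp
    | tmul x y => simp [TensorProduct.smul_tmul']
    | add x y hx hy => rw [mul_add, smul_add, hx, hy]
  let h : Fin n × Fin (Module.finrank F A) → P →ₗ[A] A := fun is =>
    { toFun := fun x => coordTensor w is.2 (f is.1 x)
      map_add' := fun x y => by rw [map_add, map_add]
      map_smul' := fun a x => by
        rw [hleft, map_smul, smul_eq_mul, hsmul, map_smul]; rfl }
  -- A dual basis over `A ⊗ Aᵒᵖ` is refined by an `F`-basis `w` of the right-hand factor.
  refine ⟨n, fun is => MulOpposite.op (w is.2) • q is.1, h, fun x => ?_, fun z hz => ?_⟩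
  · have key : ∀ (t : A ⊗[F] Aᵐᵒᵖ) (x : P),
        ∑ s, coordTensor w s t • MulOpposite.op (w s) • x = t • x := fun t x => by
      induction t using TensorProduct.induction_on with
      | zero =>
        have h0 : (0 : A ⊗[F] Aᵐᵒᵖ) • x = 0 := zero_smul (A ⊗[F] Aᵐᵒᵖ) x
        simp [h0]
      | tmul a b =>
        induction b using MulOpposite.rec' with
        | h b =>
        rw [TensorProduct.Algebra.smul_def]
        conv_rhs => rw [← w.sum_repr b, Finset.op_sum, Finset.sum_smul, Finset.smul_sum]
        refine Finset.sum_congr rfl fun s _ => ?_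
        rw [coordTensor_tmul, MulOpposite.op_smul, smul_assoc, smul_assoc,
          smul_comm a (w.repr b s), smul_comm a]
      | add t u ht hu => simp only [map_add, add_smul, Finset.sum_add_distrib, ht, hu]
    rw [Fintype.sum_prod_type]
    conv_rhs => rw [← hf x]
    exact Finset.sum_congr rfl fun i _ => key (f i x) (q i)
  -- On a pure tensor `a ⊗ b` the sum is `a` times the trace of `x ↦ b x z`.
  · have key : ∀ t : A ⊗[F] Aᵐᵒᵖ,
        ∑ s, coordTensor w s (((1 : A) ⊗ₜ[F] MulOpposite.op (w s * z)) * t) = 0 := fun t => by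
      induction t using TensorProduct.induction_on with
      | zero => simp
      | tmul a b =>
        induction b using MulOpposite.rec' with
        | h b =>
        simp only [Algebra.TensorProduct.tmul_mul_tmul, one_mul, ← MulOpposite.op_mul,
          coordTensor_tmul]
        rw [← Finset.sum_smul, sum_repr_mul_mul_eq_zero w b hz, zero_smul]
      | add t u ht hu => simp only [mul_add, map_add, Finset.sum_add_distrib, ht, hu, add_zero]
    rw [transfer_apply, Fintype.sum_prod_type]
    refine Finset.sum_eq_zero fun i _ => ?_
    rw [← key (f i (q i))]
    refine Finset.sum_congr rfl fun s _ => ?_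
    change coordTensor w s (f i (MulOpposite.op z • MulOpposite.op (w s) • q i)) = _
    rw [← mul_smul, ← MulOpposite.op_mul, hright, map_smul, smul_eq_mul]

theorem finite_of_finite_tensor_mop [Module.Finite F A] [Module.Finite (A ⊗[F] Aᵐᵒᵖ) P] :
    Module.Finite F P := by
  have := isScalarTower_tensor_mop (F := F) (A := A) (P := P)
  exact Module.Finite.trans (A ⊗[F] Aᵐᵒᵖ) P

end BimoduleTrace

/-- The stable-equivalence obstruction: on classes of nilpotent elements, the nilpotency exponent
of the `p`-power map modulo commutators is inherited. -/
theorem StablyEquivalentOfMoritaType.pow_mem_commutatorSpan {F : Type u} {A : Type uA}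
    {B : Type uB} [Field F] [Ring A] [Algebra F A] [Ring B] [Algebra F B] [Module.Finite F A]
    [Module.Finite F B] (hAB : StablyEquivalentOfMoritaType.{v} F A B) {p : ℕ} (hp : p.Prime)
    (hpF : (p : F) = 0) {m l : ℕ}
    (hB : ∀ y : B, y ^ p ^ l ∈ commutatorSpan B → y ^ p ^ m ∈ commutatorSpan B)
    {x : A} (hx : x ^ p ^ l = 0) : x ^ p ^ m ∈ commutatorSpan A := by
  obtain ⟨M, _, _, _, _, _, _, _, N, _, _, _, _, _, _, _, ⟨_, -⟩, ⟨_, -⟩,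
    ⟨Q, _, _, _, _, _, _, _, hQ, -, e', -, -⟩,
    ⟨P, _, _, _, _, _, _, _, hP, hP', e, hl, hr⟩⟩ := hAB
  have hpA : (p : A) = 0 := by rw [← map_natCast (algebraMap F A), hpF, map_zero]
  have hpB : (p : B) = 0 := by rw [← map_natCast (algebraMap F B), hpF, map_zero]
  have : Module.Finite F Q := finite_of_finite_tensor_mop (A := B)
  have : Module.Finite F (BalancedTensor F A M N) := Module.Finite.equiv e'.symm
  have : Module.Finite F M := finite_left_of_balancedTensor e hl
  have : Module.Finite F N := finite_right_of_balancedTensor e hr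
  have : Module.Finite B M := Module.Finite.of_restrictScalars_finite F B M
  have : Module.Finite A N := Module.Finite.of_restrictScalars_finite F A N
  obtain ⟨_, m', f, hm⟩ := exists_isDualBasis B M
  obtain ⟨_, n', g, hn⟩ := exists_isDualBasis A N
  obtain ⟨_, q, h, hq, hz⟩ := exists_isDualBasis_transfer_eq_zero (F := F) (A := A) (P := P)
  -- Nilpotency removes the contribution of `P`, so the composite transfer fixes the class of `x ^ p
  -- ^ m`.
  have hnil : IsNilpotent (x ^ p ^ m) := by
    refine ⟨p ^ l, ?_⟩
    rw [← pow_mul, mul_comm, pow_mul, hx, zero_pow (pow_pos hp.pos m).ne']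
  have key := toHH_transfer_transfer hm hn e hl hr hq (x ^ p ^ m)
  rw [hz _ hnil, map_zero, add_zero] at key
  rw [← toHH_eq_zero, ← key, toHH_eq_zero]
  refine transfer_mem_commutatorSpan hn ?_
  -- The hypothesis on `B` is applied to the transfer `y` of `x`: `y ^ p ^ l` has the class of the
  -- transfer of `x ^ p ^ l = 0`.
  rw [← toHH_eq_zero, toHH_transfer_pow hm hp hpB, toHH_eq_zero]
  refine hB _ ?_
  rw [← toHH_eq_zero, ← toHH_transfer_pow hm hp hpB, hx, map_zero, map_zero]

/-! ### Group algebras: commutators and conjugacy classes -/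

section ClassSum

variable {F H : Type*} [Field F] [Group H]

/-- The sums of the coefficients of an element of the group algebra over conjugacy classes. -/
noncomputable def classSum (F H : Type*) [Field F] [Group H] :
    MonoidAlgebra F H →+ (ConjClasses H →₀ F) where
  toFun y := Finsupp.mapDomain ConjClasses.mk y.coeff
  map_zero' := Finsupp.mapDomain_zero
  map_add' _ _ := Finsupp.mapDomain_add

theorem classSum_single (h : H) (c : F) :
    classSum F H (MonoidAlgebra.single h c) = Finsupp.single (ConjClasses.mk h) c :=
  Finsupp.mapDomain_single

theorem MonoidAlgebra.addHom_ext_single {Q : Type*} [AddCommMonoid Q]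
    {φ ψ : MonoidAlgebra F H →+ Q}
    (h : ∀ g c, φ (MonoidAlgebra.single g c) = ψ (MonoidAlgebra.single g c)) : φ = ψ := by
  refine DFunLike.ext _ _ fun x => ?_
  induction x using MonoidAlgebra.induction_linear with
  | zero => simp
  | add x y hx hy => rw [map_add, map_add, hx, hy]
  | single g c => exact h g c

theorem classSum_mul_comm (a b : MonoidAlgebra F H) :
    classSum F H (a * b) = classSum F H (b * a) := by
  induction a using MonoidAlgebra.induction_linear with
  | zero => simp
  | add x y hx hy => rw [add_mul, mul_add, map_add, map_add, hx, hy]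
  | single g c =>
    induction b using MonoidAlgebra.induction_linear with
    | zero => simp
    | add x y hx hy => rw [add_mul, mul_add, map_add, map_add, hx, hy]
    | single h d =>
      rw [MonoidAlgebra.single_mul_single, MonoidAlgebra.single_mul_single, classSum_single,
        classSum_single, mul_comm c d]
      congr 1
      exact ConjClasses.mk_eq_mk_iff_isConj.2 (isConj_iff.2 ⟨h, by group⟩)

/-- Conjugate group elements differ by a commutator, so choosing class representatives recovers the
class modulo commutators from the class sums. -/
theorem mem_commutatorSpan_iff_classSum {y : MonoidAlgebra F H} :
    y ∈ commutatorSpan (MonoidAlgebra F H) ↔ classSum F H y = 0 := by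
  refine ⟨fun hy => commutatorSpan_le_ker _ classSum_mul_comm hy, fun hy => ?_⟩
  let σ : (ConjClasses H →₀ F) →+ _ ⧸ commutatorSpan (MonoidAlgebra F H) :=
    Finsupp.liftAddHom fun C => (toHH (MonoidAlgebra F H)).comp
      { toFun := fun c => MonoidAlgebra.single C.out c
        map_zero' := MonoidAlgebra.single_zero _
        map_add' := MonoidAlgebra.single_add _ }
  have hσ : σ.comp (classSum F H) = toHH (MonoidAlgebra F H) := by
    refine MonoidAlgebra.addHom_ext_single fun g c => ?_
    rw [AddMonoidHom.comp_apply, classSum_single]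
    have h1 : σ (Finsupp.single (ConjClasses.mk g) c)
        = toHH _ (MonoidAlgebra.single (ConjClasses.mk g).out c) :=
      Finsupp.liftAddHom_apply_single _ _ _
    rw [h1]
    obtain ⟨u, hu⟩ := isConj_iff.1 (ConjClasses.mk_eq_mk_iff_isConj.1
      (Quotient.out_eq (ConjClasses.mk g) : ConjClasses.mk (ConjClasses.mk g).out = _))
    have h2 := toHH_mul_comm (R := MonoidAlgebra F H) (MonoidAlgebra.single u 1)
      (MonoidAlgebra.single ((ConjClasses.mk g).out * u⁻¹) c)
    simpa only [MonoidAlgebra.single_mul_single, one_mul, mul_one, inv_mul_cancel_right,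
      ← mul_assoc, hu] using h2.symm
  rw [← toHH_eq_zero, ← hσ, AddMonoidHom.comp_apply, hy, map_zero]

theorem natCast_monoidAlgebra_eq_zero {p : ℕ} [CharP F p] : (p : MonoidAlgebra F H) = 0 := by
  rw [← map_natCast (algebraMap F (MonoidAlgebra F H)), CharP.cast_eq_zero, map_zero]

variable {p : ℕ} [Fact p.Prime] [CharP F p]

/-- On class sums the `p ^ (m + t)`-power map is the `p ^ m`-power map followed by the `t`-fold
Frobenius on coefficients, which is injective over a field. The two maps therefore have the same
kernel. -/
theorem pow_mem_commutatorSpan_of_forall_pow_eq {m t : ℕ} (ht : 1 ≤ t)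
    (hH : ∀ h : H, h ^ p ^ (m + t) = h ^ p ^ m) {y : MonoidAlgebra F H}
    (hy : y ^ p ^ (m + 1) ∈ commutatorSpan (MonoidAlgebra F H)) :
    y ^ p ^ m ∈ commutatorSpan (MonoidAlgebra F H) := by
  have hp : p.Prime := Fact.out
  have hpB := natCast_monoidAlgebra_eq_zero (F := F) (H := H) (p := p)
  let σ : _ ⧸ commutatorSpan (MonoidAlgebra F H) →+ (ConjClasses H →₀ F) :=
    QuotientAddGroup.lift _ (classSum F H) (commutatorSpan_le_ker _ classSum_mul_comm)
  have hσ : ∀ k y, σ (frobHH hp hpB k y) = classSum F H (y ^ p ^ k) := fun k y => rfl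
  let φ : (ConjClasses H →₀ F) →+ (ConjClasses H →₀ F) :=
    Finsupp.mapRange.addMonoidHom (iterateFrobenius F p t).toAddMonoidHom
  have key : σ.comp (frobHH hp hpB (m + t)) = φ.comp (σ.comp (frobHH hp hpB m)) := by
    refine MonoidAlgebra.addHom_ext_single fun g c => ?_
    simp only [AddMonoidHom.comp_apply, hσ, MonoidAlgebra.single_pow, classSum_single, hH]
    simp [φ, iterateFrobenius_def, pow_add, pow_mul]
  have h1 : classSum F H (y ^ p ^ (m + t)) = 0 := by
    rw [← mem_commutatorSpan_iff_classSum, ← toHH_eq_zero]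
    have h2 := toHH_pow_pow_congr hp hpB (x := y ^ p ^ (m + 1)) (y := 0)
      (by rw [map_zero, toHH_eq_zero]; exact hy) (t - 1)
    rw [← pow_mul, ← pow_add, zero_pow (pow_pos hp.pos _).ne', map_zero] at h2
    rwa [show m + 1 + (t - 1) = m + t by omega] at h2
  have h3 := DFunLike.congr_fun key y
  simp only [AddMonoidHom.comp_apply, hσ, h1] at h3
  rw [mem_commutatorSpan_iff_classSum]
  have hinj : Function.Injective φ :=
    Finsupp.mapRange_injective _ (map_zero _) (iterateFrobenius F p t).injective
  exact hinj (h3.symm.trans (map_zero φ).symm)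

theorem single_sub_one_pow (g : H) (k : ℕ) :
    (MonoidAlgebra.single g (1 : F) - 1) ^ p ^ k
      = MonoidAlgebra.single (g ^ p ^ k) (1 : F) - 1 := by
  have : CharP (MonoidAlgebra F H) p :=
    charP_of_injective_algebraMap (algebraMap F (MonoidAlgebra F H)).injective p
  rw [sub_pow_char_pow_of_commute p k (Commute.one_right _), one_pow, MonoidAlgebra.single_pow,
    one_pow]

/-- The identity is alone in its conjugacy class. -/
theorem single_sub_one_mem_commutatorSpan {g : H}
    (h : MonoidAlgebra.single g (1 : F) - 1 ∈ commutatorSpan (MonoidAlgebra F H)) : g = 1 := by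
  rw [mem_commutatorSpan_iff_classSum, map_sub, MonoidAlgebra.one_def, classSum_single,
    classSum_single, sub_eq_zero] at h
  have := (Finsupp.single_left_inj one_ne_zero).1 h
  exact isConj_one_left.1 (ConjClasses.mk_eq_mk_iff_isConj.1 this)

end ClassSum

theorem not_stablyEquivalentOfMoritaType {F : Type u} {G : Type uA} {H : Type uB} [Field F]
    [Group G] [Finite G] [Group H] [Finite H] {p : ℕ} [Fact p.Prime] [CharP F p] {m t : ℕ}
    {g : G} (hg : g ^ p ^ (m + 1) = 1) (hg' : g ^ p ^ m ≠ 1) (ht : 1 ≤ t)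
    (hH : ∀ h : H, h ^ p ^ (m + t) = h ^ p ^ m) :
    ¬ StablyEquivalentOfMoritaType.{v} F (MonoidAlgebra F G) (MonoidAlgebra F H) := by
  intro hst
  have h1 := hst.pow_mem_commutatorSpan (Fact.out : p.Prime) (CharP.cast_eq_zero F p)
    (m := m) (l := m + 1) (fun y => pow_mem_commutatorSpan_of_forall_pow_eq ht hH)
    (x := MonoidAlgebra.single g (1 : F) - 1)
    (by rw [single_sub_one_pow, hg, ← MonoidAlgebra.one_def, sub_self])
  rw [single_sub_one_pow] at h1
  exact hg' (single_sub_one_mem_commutatorSpan h1)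

/-! ### Exponents of unipotent matrices over rings with a nilpotent uniformizer -/

section MatrixExponent

theorem Matrix.pow_card_eq_zero_of_isNilpotent {k ι : Type*} [Field k] [Fintype ι]
    [DecidableEq ι] {N : Matrix ι ι k} (hN : IsNilpotent N) : N ^ Fintype.card ι = 0 := by
  have h := (Matrix.isNilpotent_charpoly_sub_pow_of_isNilpotent hN).eq_zero
  have h1 := N.aeval_self_charpoly
  rw [sub_eq_zero.1 h] at h1
  simpa using h1

variable {R k ι : Type*} [CommRing R] [Field k] [Fintype ι] [DecidableEq ι]

/-- Over the field `k` the `n`-th power of the reduction vanishes, `n` being the size, so `N ^ n` is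
divisible by `x`; then raise to the power `r`. -/
theorem Matrix.pow_mul_eq_zero_of_isNilpotent (π : R →+* k) {x : R} {r : ℕ} (hx : x ^ r = 0)
    (hπ : ∀ a, π a = 0 → x ∣ a) {N : Matrix ι ι R} (hN : IsNilpotent N) :
    N ^ (Fintype.card ι * r) = 0 := by
  have h1 : π.mapMatrix (N ^ Fintype.card ι) = 0 := by
    rw [map_pow]
    exact Matrix.pow_card_eq_zero_of_isNilpotent (hN.map π.mapMatrix)
  have h2 : ∀ i j, x ∣ (N ^ Fintype.card ι) i j := fun i j =>
    hπ _ (congrFun (congrFun h1 i) j)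
  choose N' hN' using h2
  have h3 : N ^ Fintype.card ι = x • Matrix.of N' := by
    ext i j
    simpa using hN' i j
  rw [pow_mul, h3, smul_pow, hx, zero_smul]

theorem exists_pow_pow_eq {H : Type*} [Group H] [Finite H] [Nonempty ι] (π : R →+* k) {x : R}
    {r : ℕ} (hx : x ^ r = 0) (hπ : ∀ a, π a = 0 → x ∣ a) {p : ℕ} [hp : Fact p.Prime] [CharP R p]
    {m : ℕ} (hm : Fintype.card ι * r ≤ p ^ m) {φ : H →* Matrix ι ι R}
    (hφ : Function.Injective φ) : ∃ t, 1 ≤ t ∧ ∀ h : H, h ^ p ^ (m + t) = h ^ p ^ m := by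
  obtain ⟨e, s, hs, hcard⟩ := Nat.exists_eq_pow_mul_and_not_dvd (Nat.card_pos (α := H)).ne' p
    hp.out.ne_one
  have hs0 : 0 < s := Nat.pos_of_ne_zero fun h => hs (h ▸ dvd_zero p)
  have hco : p.Coprime s := (Nat.Prime.coprime_iff_not_dvd hp.out).2 hs
  -- With `|H| = p ^ e * s` and `s` prime to `p`, the order of `h ^ p ^ m` will be shown to divide
  -- `s`; by Euler, `t = s.totient` gives `p ^ t ≡ 1` modulo `s`.
  refine ⟨s.totient, Nat.totient_pos.2 hs0, fun h => ?_⟩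
  have h1 : (h ^ s) ^ p ^ m = 1 := by
    have hu : φ (h ^ s) ^ p ^ e = 1 := by
      rw [← map_pow, ← pow_mul, mul_comm, ← hcard, pow_card_eq_one', map_one]
    -- `h ^ s` has `p`-power order, so its image is unipotent.
    have hnil : IsNilpotent (φ (h ^ s) - 1) := ⟨p ^ e, by
      rw [sub_pow_char_pow_of_commute p e (Commute.one_right _), hu, one_pow, sub_self]⟩
    have h0 := pow_eq_zero_of_le hm (Matrix.pow_mul_eq_zero_of_isNilpotent π hx hπ hnil)
    rw [sub_pow_char_pow_of_commute p m (Commute.one_right _), one_pow, sub_eq_zero,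
      ← map_pow] at h0
    exact hφ (h0.trans (map_one φ).symm)
  obtain ⟨j, hj⟩ := (Nat.modEq_iff_dvd' (Nat.one_le_pow _ _ hp.out.pos)).1
    (Nat.ModEq.pow_totient hco).symm
  have h2 : p ^ s.totient = s * j + 1 := by
    have := Nat.one_le_pow s.totient p hp.out.pos
    omega
  rw [← pow_mul] at h1
  rw [pow_add, h2, mul_add, mul_one, pow_add, ← mul_assoc, mul_comm (p ^ m) s, pow_mul, h1,
    one_pow, one_mul]

end MatrixExponent

section TruncatedPolynomial

variable (k : Type u) [Field k]

instance TruncatedPolynomial.finite [Finite k] (r : ℕ) : Finite (TruncatedPolynomial k r) := by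
  have : Module.Finite k (TruncatedPolynomial k r) :=
    (Polynomial.monic_X_pow r).finite_quotient
  exact Module.finite_of_finite k

/-- Evaluation at zero on the truncated polynomial ring. -/
noncomputable def TruncatedPolynomial.evalZero {r : ℕ} (hr : r ≠ 0) :
    TruncatedPolynomial k r →+* k :=
  Ideal.Quotient.lift _ Polynomial.constantCoeff fun a ha => by
    obtain ⟨b, rfl⟩ := Ideal.mem_span_singleton.1 ha
    rw [map_mul, map_pow, Polynomial.constantCoeff_apply, Polynomial.coeff_X_zero, zero_pow hr,
      zero_mul]

theorem TruncatedPolynomial.exists_pow_pow_eq {p : ℕ} [Fact p.Prime] [CharP k p] {n r m : ℕ}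
    (hn : n ≠ 0) (hr : r ≠ 0) (hm : n * r ≤ p ^ m) {H : Type*} [Group H] [Finite H]
    {φ : H →* Matrix (Fin n) (Fin n) (TruncatedPolynomial k r)} (hφ : Function.Injective φ) :
    ∃ t, 1 ≤ t ∧ ∀ h : H, h ^ p ^ (m + t) = h ^ p ^ m := by
  have : Nonempty (Fin n) := ⟨⟨0, Nat.pos_of_ne_zero hn⟩⟩
  have : Nontrivial (TruncatedPolynomial k r) := (evalZero k hr).domain_nontrivial
  have : CharP (TruncatedPolynomial k r) p :=
    charP_of_injective_algebraMap (algebraMap k (TruncatedPolynomial k r)).injective p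
  refine _root_.exists_pow_pow_eq (evalZero k hr)
    (x := Ideal.Quotient.mk _ Polynomial.X) (r := r) ?_ (fun a ha => ?_) (by simpa using hm) hφ
  · rw [← map_pow, Ideal.Quotient.eq_zero_iff_mem]
    exact Ideal.mem_span_singleton_self _
  · obtain ⟨a, rfl⟩ := Ideal.Quotient.mk_surjective a
    refine map_dvd _ (Polynomial.X_dvd_iff.2 ?_)
    simpa [evalZero] using ha

end TruncatedPolynomial

/-! ### Transvections over truncated Witt vectors -/

section Transvection

theorem Matrix.SpecialLinearGroup.transvection_pow {ι R : Type*} [DecidableEq ι] [Fintype ι]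
    [CommRing R] {i j : ι} (hij : i ≠ j) (b : R) (l : ℕ) :
    transvection hij b ^ l = transvection hij (l * b) := by
  induction l with
  | zero => simp [transvection_coeff_zero]
  | succ l ih =>
    rw [pow_succ, ih]
    apply Subtype.ext
    change Matrix.transvection i j (l * b) * Matrix.transvection i j b
      = Matrix.transvection i j ((l + 1 : ℕ) * b)
    rw [Matrix.transvection_mul_transvection_same _ _ hij]
    push_cast
    ring_nf

theorem Matrix.SpecialLinearGroup.transvection_eq_one_iff {ι R : Type*} [DecidableEq ι]
    [Fintype ι] [CommRing R] {i j : ι} (hij : i ≠ j) (b : R) :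
    transvection hij b = 1 ↔ b = 0 := by
  refine ⟨fun h => ?_, fun h => by rw [h, transvection_coeff_zero]⟩
  have := congrArg (fun M : Matrix.SpecialLinearGroup ι R => (M : Matrix ι ι R) i j) h
  simpa [transvection_coe, hij] using this

/-- In characteristic `p` the Witt vector `p ^ i` has `1` in position `i` and `0` elsewhere. This
gives transvections the exact order `p ^ r`. -/
theorem TruncatedWittVector.natCast_pow_eq_zero_iff {p : ℕ} [Fact p.Prime] {k : Type*} [CommRing k]
    [Nontrivial k] [CharP k p] {r i : ℕ} :
    (p : TruncatedWittVector p r k) ^ i = 0 ↔ r ≤ i := by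
  have h : (p : TruncatedWittVector p r k) ^ i
      = WittVector.truncate r ((p : WittVector p k) ^ i) := by simp
  rw [h]
  constructor
  · intro h0
    by_contra! hi
    have := congrArg (TruncatedWittVector.coeff ⟨i, hi⟩) h0
    rw [WittVector.coeff_truncate, WittVector.coeff_p_pow, TruncatedWittVector.coeff_zero] at this
    exact one_ne_zero this
  · intro hi
    ext j
    rw [WittVector.coeff_truncate, WittVector.coeff_p_pow_eq_zero _ _ (by omega),
      TruncatedWittVector.coeff_zero]

instance TruncatedWittVector.finite {p r : ℕ} {k : Type*} [Finite k] :
    Finite (TruncatedWittVector p r k) :=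
  inferInstanceAs (Finite (Fin r → k))

end Transvection

/-- The case distinction on `r` and `p` enters only here: the bound makes unipotents over `k[t]/t^r`
have order dividing `p ^ (r - 1)`. -/
theorem mul_le_pow_sub_one {p n r : ℕ} (hpn : n ≤ p)
    (hr : (r = 2 ∧ 2 * n ≤ p) ∨ (r = 3 ∧ 3 ≤ p) ∨ (4 ≤ r ∧ 2 ≤ p)) :
    n * r ≤ p ^ (r - 1) := by
  rcases hr with ⟨rfl, h⟩ | ⟨rfl, h⟩ | ⟨h, h2⟩
  · simpa [mul_comm] using h
  · simpa [sq] using Nat.mul_le_mul hpn h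
  · obtain ⟨s, rfl⟩ := Nat.exists_eq_add_of_le h
    have h3 : 4 + s ≤ 2 ^ (s + 2) := by
      clear h
      induction s with
      | zero => norm_num
      | succ s ih => rw [show s + 1 + 2 = s + 2 + 1 by ring, pow_succ]; omega
    calc n * (4 + s) ≤ p * p ^ (s + 2) :=
          Nat.mul_le_mul hpn (h3.trans (Nat.pow_le_pow_left h2 _))
      _ = p ^ (4 + s - 1) := by rw [← pow_succ']; congr 1; omega

theorem theoremA {p : ℕ} [Fact p.Prime] (n r : ℕ) (k : Type uA) [Field k] [Finite k] [CharP k p]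
    (F : Type u) [Field F] [CharP F p] [PerfectField F]
    (hn : 2 ≤ n) (hpn : n ≤ p)
    (hr : (r = 2 ∧ 2 * n ≤ p) ∨ (r = 3 ∧ 3 ≤ p) ∨ (4 ≤ r ∧ 2 ≤ p)) :
    ¬ StablyEquivalentOfMoritaType.{v} F
        (MonoidAlgebra F (Matrix.GeneralLinearGroup (Fin n) (TruncatedWittVector p r k)))
        (MonoidAlgebra F (Matrix.GeneralLinearGroup (Fin n) (TruncatedPolynomial k r))) ∧
    ¬ StablyEquivalentOfMoritaType.{v} F
        (MonoidAlgebra F (Matrix.SpecialLinearGroup (Fin n) (TruncatedWittVector p r k)))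
        (MonoidAlgebra F (Matrix.SpecialLinearGroup (Fin n) (TruncatedPolynomial k r))) := by
  have hm := mul_le_pow_sub_one hpn hr
  have hr1 : r - 1 + 1 = r := by omega
  have hij : (⟨0, by omega⟩ : Fin n) ≠ ⟨1, by omega⟩ := by simp
  -- The elementary matrix with off-diagonal entry `1`; its `p ^ l`-th power has entry `p ^ l`, and
  -- its image serves for `GL` too.
  let g : Matrix.SpecialLinearGroup (Fin n) (TruncatedWittVector p r k) :=
    Matrix.SpecialLinearGroup.transvection hij 1
  have hg : ∀ l, g ^ p ^ l = 1 ↔ r ≤ l := fun l => by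
    rw [Matrix.SpecialLinearGroup.transvection_pow,
      Matrix.SpecialLinearGroup.transvection_eq_one_iff, mul_one, Nat.cast_pow,
      TruncatedWittVector.natCast_pow_eq_zero_iff]
  have hg' : ∀ l, Matrix.SpecialLinearGroup.toGL g ^ p ^ l = 1 ↔ r ≤ l := fun l => by
    rw [← hg, ← map_pow, map_eq_one_iff _ Matrix.SpecialLinearGroup.toGL_injective]
  constructor
  · obtain ⟨t, ht, hH⟩ := TruncatedPolynomial.exists_pow_pow_eq k (p := p) (by omega) (by omega) hm
      (φ := Units.coeHom (Matrix (Fin n) (Fin n) (TruncatedPolynomial k r))) Units.val_injective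
    exact not_stablyEquivalentOfMoritaType ((hg' _).2 hr1.ge)
      (fun h => by have := (hg' _).1 h; omega) ht hH
  · obtain ⟨t, ht, hH⟩ := TruncatedPolynomial.exists_pow_pow_eq k (p := p) (by omega) (by omega) hm
      (φ := ({ toFun := fun A => A.1, map_one' := rfl, map_mul' := fun _ _ => rfl } :
        Matrix.SpecialLinearGroup (Fin n) (TruncatedPolynomial k r) →* _)) Subtype.val_injective
    exact not_stablyEquivalentOfMoritaType ((hg _).2 hr1.ge)
      (fun h => by have := (hg _).1 h; omega) ht hH
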